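/- Let $n,m\ge 1$ be integers, $r>0$, and let $Z=[-\tfrac12,\tfrac12]^n\times rB_2^m\subset\mathbb R^{n+m}$, where $B_2^m=\{x\in\mathbb R^m:\|x\|_2\le 1\}$. Let $a\in\mathbb R^{n+m}$ with $\|a\|_2=1$ and $H_a=\{x\in\mathbb R^{n+m}:\langle a,x\rangle=0\}$. For $\nu\ge 0$ let $j_\nu$ be the normalized Bessel function, $j_\nu(s)=2^\nu\Gamma(\nu+1)J_\nu(s)/s^\nu$ for $s>0$ and $j_\nu(0)=1$, where $J_\nu$ is the Bessel function of the first kind of order $\nu$. If $a=(a_1,\dots,a_n,a_{n+1},0,\dots,0)$ with $a_{n+1}\ge 0$, then $$\operatorname{vol}_{n+m-1}(H_a\cap Z)=r^m\,\frac{\pi^{\frac m2-1}}{\Gamma\left(\frac m2+1\right)}\int_0^\infty\ \prod_{j=1}^n\frac{\sin\left(\frac{a_js}{2}\right)}{\frac{a_js}{2}}\cdot j_{\frac m2}(a_{n+1}rs)\,ds .$$ For an arbitrary unit vector $a=(a_1,\dots,a_{n+m})$ the same formula holds with $a_{n+1}$ replaced by $\left(a_{n+1}^2+\dots+a_{n+m}^2\right)^{1/2}$.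 Here $\operatorname{vol}_{n+m-1}$ is Lebesgue measure on the hyperplane $H_a$, a factor $\sin(x)/x$ is read as $1$ at $x=0$, and the integral is the improper integral $\lim_{T\to\infty}\int_0^T$, whose convergence is part of the claim. -/

import Mathlib

open MeasureTheory Filter Topology

noncomputable section

/-- The Bessel function `J_ν` of the first kind on `x > 0`, given by its (everywhere convergent)
series `∑ (-1)^k / (k! Γ(k + ν + 1)) (x / 2)^(2k + ν)`. -/
def besselJ (ν x : ℝ) : ℝ :=
  ∑' k : ℕ, (-1 : ℝ) ^ k / ((k.factorial : ℝ) * Real.Gamma ((k : ℝ) + ν + 1)) *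
    (x / 2) ^ (2 * (k : ℝ) + ν)

/-- The normalized Bessel function `j_ν` on `x ≥ 0`. -/
def normalizedBessel (ν x : ℝ) : ℝ :=
  if x = 0 then 1 else 2 ^ ν * Real.Gamma (ν + 1) * (besselJ ν x / x ^ ν)

/-- The Euclidean norm of the block of the last `m` coordinates of a vector of `ℝ^(n+m)`. -/
def lastBlockNorm {n m : ℕ} (x : EuclideanSpace ℝ (Fin (n + m))) : ℝ :=
  √(∑ k : Fin m, x (Fin.natAdd n k) ^ 2)

/-- The generalized cylinder `Z = [-1/2, 1/2]^n × r B_2^m` in `ℝ^(n+m)`. -/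
def generalizedCylinder (n m : ℕ) (r : ℝ) : Set (EuclideanSpace ℝ (Fin (n + m))) :=
  {x | (∀ j : Fin n, x (Fin.castAdd m j) ∈ Set.Icc (-(1 / 2) : ℝ) (1 / 2)) ∧ lastBlockNorm x ≤ r}

/-- The central hyperplane `H_a = {x | ⟨a, x⟩ = 0}`. -/
def centralHyperplane {d : ℕ} (a : EuclideanSpace ℝ (Fin d)) :
    Submodule ℝ (EuclideanSpace ℝ (Fin d)) :=
  LinearMap.ker (innerSL ℝ a).toLinearMap

/-- The volume of `A ∩ V` with respect to the Lebesgue measure of the Euclidean subspace `V`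
(the Haar measure giving volume `1` to a cube spanned by an orthonormal basis of `V`). The measure
is named explicitly, because it differs from the restriction of the ambient Lebesgue measure
to the subtype. -/
def sectionVolume {d : ℕ} (V : Submodule ℝ (EuclideanSpace ℝ (Fin d)))
    (A : Set (EuclideanSpace ℝ (Fin d))) : ENNReal :=
  (stdOrthonormalBasis ℝ V).toBasis.addHaar ((↑) ⁻¹' A : Set V)

/-- The improper integral `∫_0^∞ f(s) ds = lim_{T → ∞} ∫_0^T f(s) ds` converges and has
value `I`. -/
def HasImproperIntegral (f : ℝ → ℝ) (I : ℝ) : Prop :=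
  (∀ T : ℝ, 0 < T → IntervalIntegrable f volume 0 T) ∧
    Tendsto (fun T : ℝ => ∫ s in (0 : ℝ)..T, f s) atTop (𝓝 I)

/-- The function `s ↦ ∏_{j ≤ n} sinc(a_j s / 2) · j_{m/2}(c r s)`; here `sinc 0 = 1`. -/
def cylinderIntegrand (n m : ℕ) (r : ℝ) (a : EuclideanSpace ℝ (Fin (n + m))) (c s : ℝ) : ℝ :=
  (∏ j : Fin n, Real.sinc (a (Fin.castAdd m j) * s / 2)) *
    normalizedBessel ((m : ℝ) / 2) (c * r * s)

end

/-!
Let `A t` be the volume of the section of the cylinder `Z` by the hyperplane `⟨a, x⟩ = t`. The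
formula is Fourier inversion for `A` at the origin, combined with an evaluation of the cosine
transform of `A`.

By Cavalieri's principle (`setIntegral_height_eq`) the cosine transform of `A` at `s` equals
`∫ x in Z, cos (s ⟨a, x⟩)`. As `Z` is a product, this factors into sinc functions, one for each side
of the cube, and the transform of a ball (`setIntegral_generalizedCylinder_cos`). Slicing the ball
once more reduces its transform to Poisson's integral for the Bessel function
(`integral_cos_mul_sqrt_eq_bessel`), which is obtained by integrating the cosine series term by term
against a Beta integral.

The transform of `A` need not be absolutely integrable, so inversion is done for improper integrals
(`tendsto_integral_cosTransform`), which needs a Dini condition at the origin. Since `Z` is convex and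
contains a ball about the origin, `A` is even Lipschitz there (`sliceVolume_lipschitz_zero`): a
contraction towards `± ε a` maps each section near the origin into the central one, and vice versa,
which bounds the ratio of their volumes. The Lipschitz condition makes `(A t - A 0 exp (-t² / 2)) / t`
integrable, so by the Riemann–Lebesgue lemma the partial integrals of the transform of `A` have the
same limit as those of the transform of `A 0 exp (-t² / 2)`, namely `π A 0`.
-/

/-! ### Pointwise inversion of the cosine transform -/

theorem integrable_mul_cos {f : ℝ → ℝ} (hf : Integrable f) (s : ℝ) :
    Integrable fun t => f t * Real.cos (s * t) :=
  hf.mul_bdd (c := 1) (by fun_prop) (Eventually.of_forall fun t => Real.abs_cos_le_one _)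

theorem continuous_cosTransform {f : ℝ → ℝ} (hf : Integrable f) :
    Continuous fun s : ℝ => ∫ t, f t * Real.cos (s * t) := by
  refine continuous_of_dominated (bound := fun t => ‖f t‖)
    (fun s => (integrable_mul_cos hf s).aestronglyMeasurable) (fun s => ?_) hf.norm ?_
  · refine Eventually.of_forall fun t => ?_
    rw [norm_mul]
    exact mul_le_of_le_one_right (norm_nonneg _) (Real.abs_cos_le_one _)
  · exact Eventually.of_forall fun t => by fun_prop

/-- The Riemann–Lebesgue lemma for the sine transform. -/
theorem tendsto_integral_mul_sin_atTop {f : ℝ → ℝ} (hf : Integrable f) :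
    Tendsto (fun T : ℝ => ∫ t, f t * Real.sin (T * t)) atTop (𝓝 0) := by
  have h := (Real.tendsto_integral_exp_smul_cocompact (fun t => (f t : ℂ))).mono_left
    (atTop_le_cocompact (α := ℝ))
  have h2 : Tendsto (fun T : ℝ => T / (2 * Real.pi)) atTop atTop :=
    tendsto_id.atTop_div_const (by positivity)
  have h3 := (Complex.continuous_im.tendsto _).comp (h.comp h2)
  have h4 := h3.neg
  simp only [Complex.zero_im, neg_zero] at h4
  refine h4.congr fun T => ?_
  simp only [Function.comp_apply]
  have hint : Integrable fun v : ℝ =>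
      (Real.fourierChar (-(v * (T / (2 * Real.pi))))) • (f v : ℂ) := by
    have : Integrable fun v : ℝ => (f v : ℂ) := hf.ofReal
    refine (this.norm).mono' ?_ ?_
    · refine AEStronglyMeasurable.smul ?_ this.aestronglyMeasurable
      refine Continuous.aestronglyMeasurable ?_
      exact continuous_subtype_val.comp (Real.continuous_fourierChar.comp
        (f := fun v : ℝ => -(v * (T / (2 * Real.pi)))) (by fun_prop))
    · exact Eventually.of_forall fun v => by simp
  rw [← Complex.imCLM_apply, ← Complex.imCLM.integral_comp_comm hint, ← integral_neg]
  refine integral_congr_ae (Eventually.of_forall fun v => ?_)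
  have e : 2 * Real.pi * -(v * (T / (2 * Real.pi))) = -(T * v) := by
    field_simp
  simp only [Complex.imCLM_apply, Circle.smul_def, Real.fourierChar_apply, e, smul_eq_mul]
  rw [Complex.im_mul_ofReal, Complex.exp_ofReal_mul_I_im, Real.sin_neg]
  ring

theorem integral_cos_mul_eq_sinc (T t : ℝ) :
    ∫ s in (0 : ℝ)..T, Real.cos (s * t) = T * Real.sinc (T * t) := by
  rcases eq_or_ne t 0 with rfl | ht
  · simp
  · rw [intervalIntegral.integral_comp_mul_right (fun x => Real.cos x) ht]
    rcases eq_or_ne T 0 with rfl | hT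
    · simp
    · rw [Real.sinc_of_ne_zero (mul_ne_zero hT ht)]
      simp
      field_simp

theorem intervalIntegral_cosTransform {f : ℝ → ℝ} (hf : Integrable f) (T : ℝ) :
    ∫ s in (0 : ℝ)..T, ∫ t, f t * Real.cos (s * t) = ∫ t, f t * (T * Real.sinc (T * t)) := by
  have hint : Integrable (Function.uncurry fun s t : ℝ => f t * Real.cos (s * t))
      ((volume.restrict (Set.uIoc 0 T)).prod volume) := by
    have : IsFiniteMeasure (volume.restrict (Set.uIoc 0 T)) :=
      ⟨by rw [Measure.restrict_apply_univ, Set.uIoc]; exact measure_Ioc_lt_top⟩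
    have h1 := hf.comp_snd (volume.restrict (Set.uIoc 0 T))
    exact h1.mul_bdd (c := 1) (by fun_prop)
      (Eventually.of_forall fun p => Real.abs_cos_le_one _)
  rw [intervalIntegral_integral_swap hint]
  refine integral_congr_ae (Eventually.of_forall fun t => ?_)
  simp only [intervalIntegral.integral_const_mul, integral_cos_mul_eq_sinc]

/-- Inversion at the origin for the Gaussian `exp (-t² / 2)`: its cosine transform integrates to
`π`. -/
theorem tendsto_integral_cosTransform_gaussian :
    Tendsto (fun T : ℝ => ∫ s in (0 : ℝ)..T, ∫ t, Real.exp (-(1 / 2) * t ^ 2) * Real.cos (s * t))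
      atTop (𝓝 Real.pi) := by
  have h1 : ∀ s : ℝ, ∫ t, Real.exp (-(1 / 2) * t ^ 2) * Real.cos (s * t) =
      √(2 * Real.pi) * Real.exp (-(1 / 2) * s ^ 2) := by
    intro s
    have h := fourierIntegral_gaussian (b := 1 / 2) (by norm_num) (s : ℂ)
    have hre := congrArg Complex.re h
    have hint : Integrable fun x : ℝ =>
        Complex.exp (Complex.I * s * x) * Complex.exp (-(1 / 2) * (x : ℂ) ^ 2) := by
      have := (integrable_exp_neg_mul_sq (b := 1 / 2) (by norm_num)).ofReal (𝕜 := ℂ)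
      refine this.norm.mono' (by fun_prop) (Eventually.of_forall fun x => ?_)
      rw [norm_mul, show Complex.I * s * x = ((s * x : ℝ) : ℂ) * Complex.I by push_cast; ring,
        Complex.norm_exp_ofReal_mul_I, one_mul]
      rw [show -(1 / 2) * (x : ℂ) ^ 2 = ((-(1 / 2) * x ^ 2 : ℝ) : ℂ) by push_cast; ring,
        ← Complex.ofReal_exp]
      exact le_rfl
    rw [← Complex.reCLM_apply, ← Complex.reCLM.integral_comp_comm hint] at hre
    have e1 : ∀ x : ℝ, Complex.reCLM (Complex.exp (Complex.I * s * x) *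
        Complex.exp (-(1 / 2) * (x : ℂ) ^ 2)) =
        Real.exp (-(1 / 2) * x ^ 2) * Real.cos (s * x) := by
      intro x
      rw [show Complex.I * s * x = ((s * x : ℝ) : ℂ) * Complex.I by push_cast; ring,
        show -(1 / 2) * (x : ℂ) ^ 2 = ((-(1 / 2) * x ^ 2 : ℝ) : ℂ) by push_cast; ring,
        ← Complex.ofReal_exp, Complex.reCLM_apply, Complex.re_mul_ofReal,
        Complex.exp_ofReal_mul_I_re, mul_comm]
    simp only [e1] at hre
    rw [hre]
    have e2 : ((Real.pi : ℂ) / (1 / 2)) ^ (1 / 2 : ℂ) = ((√(2 * Real.pi) : ℝ) : ℂ) := by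
      rw [Real.sqrt_eq_rpow, Complex.ofReal_cpow (by positivity)]
      push_cast
      congr 1
      ring
    rw [e2, show -(s : ℂ) ^ 2 / (4 * (1 / 2)) = ((-(1 / 2) * s ^ 2 : ℝ) : ℂ) by push_cast; ring,
      ← Complex.ofReal_exp, ← Complex.ofReal_mul, Complex.ofReal_re]
  simp only [h1]
  have h2 := intervalIntegral_tendsto_integral_Ioi (μ := volume) (0 : ℝ)
    ((integrable_exp_neg_mul_sq (b := 1 / 2) (by norm_num)).const_mul
      (√(2 * Real.pi))).integrableOn tendsto_id
  rw [integral_const_mul, integral_gaussian_Ioi, show Real.pi / (1 / 2) = 2 * Real.pi by ring,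
    mul_div_assoc', Real.mul_self_sqrt (by positivity), mul_div_cancel_left₀ _ two_ne_zero] at h2
  exact h2

/-- Fourier inversion at the origin, as an improper integral, for a function satisfying a
Lipschitz condition there. -/
theorem tendsto_integral_cosTransform {f : ℝ → ℝ} (hf : Integrable f) {C δ : ℝ} (hδ : 0 < δ)
    (hlip : ∀ t, |t| ≤ δ → |f t - f 0| ≤ C * |t|) :
    Tendsto (fun T : ℝ => ∫ s in (0 : ℝ)..T, ∫ t, f t * Real.cos (s * t)) atTop
      (𝓝 (Real.pi * f 0)) := by
  -- Subtracting a Gaussian with the same value at `0` leaves `h` with `h t / t` integrable, whose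
  -- contribution tends to zero by the Riemann–Lebesgue lemma.
  set g : ℝ → ℝ := fun t => Real.exp (-(1 / 2) * t ^ 2) with hg
  have hgi : Integrable g := integrable_exp_neg_mul_sq (by norm_num)
  set h : ℝ → ℝ := fun t => f t - f 0 * g t with hh
  have hhi : Integrable h := hf.sub (hgi.const_mul _)
  have h0 : h 0 = 0 := by simp [hh, hg]
  have hsmall : ∀ t, |t| ≤ min δ 1 → |h t| ≤ (C + |f 0|) * |t| := by
    intro t ht
    have h1 := hlip t (ht.trans (min_le_left _ _))
    have h2 : |t| ≤ 1 := ht.trans (min_le_right _ _)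
    have h3 : |1 - g t| ≤ |t| := by
      have h4 : g t ≤ 1 := by
        simp only [hg]
        exact Real.exp_le_one_iff.mpr (by nlinarith [sq_nonneg t])
      rw [abs_of_nonneg (by linarith)]
      have h5 := Real.add_one_le_exp (-(1 / 2) * t ^ 2)
      have h6 : t ^ 2 ≤ |t| := by
        rw [← sq_abs]; nlinarith [abs_nonneg t]
      have h7 : g t = Real.exp (-(1 / 2) * t ^ 2) := rfl
      nlinarith [sq_nonneg t]
    have h8 : h t = (f t - f 0) + f 0 * (1 - g t) := by simp only [hh]; ring
    rw [h8]
    refine (abs_add_le _ _).trans ?_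
    rw [abs_mul, add_mul]
    gcongr
  have hki : Integrable fun t => h t / t := by
    have hb : Integrable fun t : ℝ =>
        (Set.Icc (-(min δ 1)) (min δ 1)).indicator (fun _ => abs (C + |f 0|)) t +
          (min δ 1)⁻¹ * |h t| := by
      refine Integrable.add ?_ (hhi.abs.const_mul _)
      rw [integrable_indicator_iff measurableSet_Icc]
      exact integrableOn_const (by simp)
    refine hb.mono' (hhi.aestronglyMeasurable.div₀ (by fun_prop)) (Eventually.of_forall fun t => ?_)
    have hδ1 : 0 < min δ 1 := lt_min hδ one_pos
    rw [norm_div, Real.norm_eq_abs, Real.norm_eq_abs]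
    rcases eq_or_ne t 0 with rfl | ht0
    · rw [h0]
      simp only [abs_zero, div_zero, mul_zero, add_zero]
      exact Set.indicator_nonneg (fun _ _ => abs_nonneg _) _
    have htp : 0 < |t| := abs_pos.mpr ht0
    by_cases ht : |t| ≤ min δ 1
    · rw [Set.indicator_of_mem (Set.mem_Icc.mpr (abs_le.mp ht))]
      refine le_add_of_le_of_nonneg ?_ (by positivity)
      rw [div_le_iff₀ htp]
      exact (hsmall t ht).trans (by gcongr; exact le_abs_self _)
    · rw [Set.indicator_of_notMem (fun hm => ht (abs_le.mpr (Set.mem_Icc.mp hm))), zero_add,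
        div_eq_inv_mul]
      push Not at ht
      gcongr
  have hRL := tendsto_integral_mul_sin_atTop hki
  have hlim := hRL.add (tendsto_integral_cosTransform_gaussian.const_mul (f 0))
  rw [zero_add, mul_comm (f 0)] at hlim
  refine hlim.congr fun T => ?_
  rw [← intervalIntegral.integral_const_mul]
  have e1 : ∫ t, h t / t * Real.sin (T * t) = ∫ s in (0 : ℝ)..T, ∫ t, h t * Real.cos (s * t) := by
    rw [intervalIntegral_cosTransform hhi]
    refine integral_congr_ae (Eventually.of_forall fun t => ?_)
    simp only
    rcases eq_or_ne t 0 with rfl | ht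
    · simp [h0]
    rcases eq_or_ne T 0 with rfl | hT
    · simp
    rw [Real.sinc_of_ne_zero (mul_ne_zero hT ht)]
    field_simp
  rw [e1, ← intervalIntegral.integral_add
    ((continuous_cosTransform hhi).intervalIntegrable _ _)
    (((continuous_cosTransform hgi).const_mul _).intervalIntegrable _ _)]
  refine intervalIntegral.integral_congr fun s _ => ?_
  rw [← integral_const_mul, ← integral_add (integrable_mul_cos hhi s)
    ((integrable_mul_cos hgi s).const_mul _)]
  refine integral_congr_ae (Eventually.of_forall fun t => ?_)
  simp only [hh]
  ring

/-! ### Slicing by parallel hyperplanes -/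

section Slicing

open scoped Pointwise

variable {E F : Type*} [NormedAddCommGroup E] [InnerProductSpace ℝ E]
  [NormedAddCommGroup F] [InnerProductSpace ℝ F] {a : E} {ι : F →ₗᵢ[ℝ] E}

theorem inner_smul_add (ha : ‖a‖ = 1) (horth : ∀ v, inner ℝ a (ι v) = 0) (t : ℝ) (v : F) :
    inner ℝ a (t • a + ι v) = t := by
  rw [inner_add_right, inner_smul_right, horth, real_inner_self_eq_norm_sq, ha]; ring

variable [FiniteDimensional ℝ F] [MeasurableSpace F] [BorelSpace F]

/-- The volume of the section of `K` by the affine hyperplane at signed distance `t` from the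
origin with unit normal `a`. The space `F` with the isometric embedding `ι` is a model of the
hyperplane `a^⊥`, so the section is `{v | t a + ι v ∈ K}`. -/
noncomputable def sliceVolume (a : E) (ι : F →ₗᵢ[ℝ] E) (K : Set E) (t : ℝ) : ℝ :=
  volume.real {v : F | t • a + ι v ∈ K}

theorem volume_slice_lt_top {K : Set E} (hKb : Bornology.IsBounded K) (t : ℝ) :
    volume {v : F | t • a + ι v ∈ K} < ⊤ := by
  obtain ⟨R, hR⟩ := hKb.subset_closedBall 0
  refine (measure_mono (t := Metric.closedBall (0 : F) (R + ‖t • a‖)) fun v hv => ?_).trans_lt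
    measure_closedBall_lt_top
  have h1 : ‖t • a + ι v‖ ≤ R := by simpa using hR hv
  have h2 : ‖ι v‖ ≤ ‖t • a + ι v‖ + ‖t • a‖ := by
    simpa using norm_sub_le (t • a + ι v) (t • a)
  rw [ι.norm_map] at h2
  simp only [mem_closedBall_zero_iff]
  linarith

/-- Contracting a slice towards the point `σ ε a` of the convex body `K` lands in another slice. -/
theorem pow_mul_sliceVolume_le (ha : ‖a‖ = 1) {K : Set E} (hKc : Convex ℝ K)
    (hKb : Bornology.IsBounded K) {ε : ℝ} (hε : 0 ≤ ε) (hball : Metric.closedBall 0 ε ⊆ K)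
    {l σ : ℝ} (hl0 : 0 ≤ l) (hl1 : l ≤ 1) (hσ : |σ| ≤ 1) (t : ℝ) :
    l ^ Module.finrank ℝ F * sliceVolume a ι K t ≤
      sliceVolume a ι K (l * t + (1 - l) * (σ * ε)) := by
  have hsub : (l • {v : F | t • a + ι v ∈ K} : Set F) ⊆
      {v : F | (l * t + (1 - l) * (σ * ε)) • a + ι v ∈ K} := by
    rintro _ ⟨v, hv, rfl⟩
    have hp : (σ * ε) • a ∈ K := hball (by
      rw [mem_closedBall_zero_iff, norm_smul, ha, mul_one, Real.norm_eq_abs, abs_mul,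
        abs_of_nonneg hε]
      exact mul_le_of_le_one_left hε hσ)
    have := hKc hv hp hl0 (sub_nonneg.mpr hl1) (by ring)
    have e : (l * t + (1 - l) * (σ * ε)) • a + ι (l • v) =
        l • (t • a + ι v) + (1 - l) • (σ * ε) • a := by
      rw [map_smul, smul_add, add_smul, mul_smul, mul_smul]
      abel
    rw [← e] at this
    exact this
  have h := measureReal_mono hsub (volume_slice_lt_top hKb _).ne
  rwa [measureReal_def, Measure.addHaar_smul_of_nonneg _ hl0, ENNReal.toReal_mul,
    ENNReal.toReal_ofReal (by positivity)] at h

/-- The section function of a convex body containing a ball about the origin is Lipschitz at `0`. -/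
theorem sliceVolume_lipschitz_zero (ha : ‖a‖ = 1) {K : Set E} (hKc : Convex ℝ K)
    (hKb : Bornology.IsBounded K) {ε : ℝ} (hε : 0 < ε) (hball : Metric.closedBall 0 ε ⊆ K) :
    ∃ C δ : ℝ, 0 < δ ∧
      ∀ t, |t| ≤ δ → |sliceVolume a ι K t - sliceVolume a ι K 0| ≤ C * |t| := by
  set k : ℕ := Module.finrank ℝ F with hk
  set A := sliceVolume a ι K with hA
  have hA0 : ∀ t, 0 ≤ A t := fun t => measureReal_nonneg
  refine ⟨2 * (k / ε) * A 0, min ε (ε / (2 * (k + 1))), by positivity, fun t ht => ?_⟩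
  have ht1 : |t| ≤ ε := ht.trans (min_le_left _ _)
  have ht2 : k / ε * |t| ≤ 1 / 2 := by
    have := ht.trans (min_le_right _ _)
    rw [le_div_iff₀ (by positivity)] at this
    rw [div_mul_eq_mul_div, div_le_iff₀ hε]
    nlinarith [abs_nonneg t]
  obtain ⟨σ, hσ, hσt⟩ : ∃ σ : ℝ, |σ| ≤ 1 ∧ σ * |t| = t := by
    rcases abs_cases t with ⟨h, _⟩ | ⟨h, _⟩
    · exact ⟨1, by simp, by rw [h]; ring⟩
    · exact ⟨-1, by simp, by rw [h]; ring⟩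
  -- From height `0` to height `t`, contracting towards `± ε a`.
  have h1 : (1 - k / ε * |t|) * A 0 ≤ A t := by
    have hx : |t| / ε ≤ 1 := (div_le_one hε).mpr ht1
    have h := pow_mul_sliceVolume_le (ι := ι) ha hKc hKb hε.le hball (l := 1 - |t| / ε) (σ := σ)
      (by linarith) (by linarith [show 0 ≤ |t| / ε by positivity]) hσ 0
    have e : (1 - |t| / ε) * 0 + (1 - (1 - |t| / ε)) * (σ * ε) = t := by
      have : |t| / ε * ε = |t| := by field_simp
      linear_combination σ * this + hσt
    rw [e] at h
    refine (mul_le_mul_of_nonneg_right ?_ (hA0 0)).trans h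
    have hb := one_add_mul_le_pow (a := -(|t| / ε)) (by linarith) k
    calc 1 - k / ε * |t| = 1 + k * -(|t| / ε) := by ring
      _ ≤ _ := hb
      _ = _ := by ring
  -- From height `t` to height `0`, contracting towards `∓ ε a`.
  have h2 : (1 - k / ε * |t|) * A t ≤ A 0 := by
    have hpos : 0 < ε + |t| := by positivity
    have hx : |t| / (ε + |t|) ≤ |t| / ε := by gcongr; linarith [abs_nonneg t]
    have hx1 : |t| / (ε + |t|) ≤ 1 := (div_le_one hpos).mpr (by linarith)
    have h := pow_mul_sliceVolume_le (ι := ι) ha hKc hKb hε.le hball (l := 1 - |t| / (ε + |t|))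
      (σ := -σ) (by linarith) (by linarith [show 0 ≤ |t| / (ε + |t|) by positivity])
      (by rwa [abs_neg]) t
    have e : (1 - |t| / (ε + |t|)) * t + (1 - (1 - |t| / (ε + |t|))) * (-σ * ε) = 0 := by
      field_simp
      linear_combination (-ε) * hσt
    rw [e] at h
    refine (mul_le_mul_of_nonneg_right ?_ (hA0 t)).trans h
    have hb := one_add_mul_le_pow (a := -(|t| / (ε + |t|))) (by linarith) k
    calc 1 - k / ε * |t| = 1 - k * (|t| / ε) := by ring
      _ ≤ 1 - k * (|t| / (ε + |t|)) := by gcongr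
      _ = 1 + k * -(|t| / (ε + |t|)) := by ring
      _ ≤ _ := hb
      _ = _ := by ring
  have hx0 : 0 ≤ k / ε * |t| := by positivity
  have h3 : A t ≤ 2 * A 0 := by nlinarith [hA0 t]
  rw [abs_le]
  constructor
  · nlinarith [hA0 0, mul_nonneg hx0 (hA0 0)]
  · nlinarith [mul_le_mul_of_nonneg_left h3 hx0]

variable [MeasurableSpace E] [BorelSpace E]

/-- Integrating a function of the height over a slice. -/
theorem integral_indicator_slice (ha : ‖a‖ = 1) (horth : ∀ v, inner ℝ a (ι v) = 0)
    {K : Set E} (hK : MeasurableSet K) (g : ℝ → ℝ) (t : ℝ) :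
    ∫ v : F, K.indicator (fun x => g (inner ℝ a x)) (t • a + ι v) = sliceVolume a ι K t * g t := by
  have h : (fun v : F => K.indicator (fun x => g (inner ℝ a x)) (t • a + ι v)) =
      {v : F | t • a + ι v ∈ K}.indicator fun _ => g t := by
    ext v
    by_cases hv : t • a + ι v ∈ K
    · rw [Set.indicator_of_mem hv, inner_smul_add ha horth,
        Set.indicator_of_mem (show v ∈ {v : F | t • a + ι v ∈ K} from hv)]
    · rw [Set.indicator_of_notMem hv,
        Set.indicator_of_notMem (show v ∉ {v : F | t • a + ι v ∈ K} from hv)]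
  rw [h]
  refine (integral_indicator_const _
    ((show Continuous fun v : F => t • a + ι v by fun_prop).measurable hK)).trans ?_
  rw [smul_eq_mul]
  rfl

variable [FiniteDimensional ℝ E]

/-- The coordinates `(t, v) ↦ t a + ι v` preserve Lebesgue measure, as they form an isometry from
the `L²` product. -/
theorem measurePreserving_smul_add (ha : ‖a‖ = 1) (horth : ∀ v, inner ℝ a (ι v) = 0)
    (hspan : ∀ x : E, inner ℝ a x = 0 → ∃ v, ι v = x) :
    MeasurePreserving (fun p : ℝ × F => p.1 • a + ι p.2) := by
  let L : WithLp 2 (ℝ × F) →ₗᵢ[ℝ] E :=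
    { toFun := fun p => p.fst • a + ι p.snd
      map_add' := fun p q => by
        simp only [WithLp.add_fst, WithLp.add_snd, map_add, add_smul]; abel
      map_smul' := fun c p => by
        simp [smul_add, mul_smul]
      norm_map' := fun p => by
        have h : ‖p.fst • a + ι p.snd‖ ^ 2 = ‖p‖ ^ 2 := by
          rw [norm_add_sq_real, WithLp.prod_norm_sq_eq_of_L2, inner_smul_left, horth]
          simp [norm_smul, ha]
        exact (sq_eq_sq₀ (norm_nonneg _) (norm_nonneg _)).mp h }
  have hL : Function.Surjective L := fun x => by
    obtain ⟨v, hv⟩ := hspan (x - (inner ℝ a x : ℝ) • a) (by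
      rw [inner_sub_right, inner_smul_right, real_inner_self_eq_norm_sq, ha]; ring)
    refine ⟨WithLp.toLp 2 (inner ℝ a x, v), ?_⟩
    change (inner ℝ a x : ℝ) • a + ι v = x
    rw [hv]; abel
  exact (LinearIsometryEquiv.ofSurjective L hL).measurePreserving.comp
    (WithLp.volume_preserving_toLp ℝ F)


theorem integrable_indicator_height {K : Set E} (hK : MeasurableSet K) (hKv : volume K ≠ ⊤)
    {g : ℝ → ℝ} (hg : Continuous g) (hg1 : ∀ t, |g t| ≤ 1) :
    Integrable (K.indicator fun x => g (inner ℝ a x)) := by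
  rw [integrable_indicator_iff hK]
  refine Measure.integrableOn_of_bounded (M := 1) hKv ?_ (Eventually.of_forall fun x => hg1 _)
  exact (hg.comp (by fun_prop)).aestronglyMeasurable

/-- Cavalieri's principle for functions of the height. -/
theorem setIntegral_height_eq (ha : ‖a‖ = 1) (horth : ∀ v, inner ℝ a (ι v) = 0)
    (hspan : ∀ x : E, inner ℝ a x = 0 → ∃ v, ι v = x) {K : Set E} (hK : MeasurableSet K)
    (hKv : volume K ≠ ⊤) {g : ℝ → ℝ} (hg : Continuous g) (hg1 : ∀ t, |g t| ≤ 1) :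
    ∫ x in K, g (inner ℝ a x) = ∫ t, sliceVolume a ι K t * g t := by
  have hmp := measurePreserving_smul_add ha horth hspan
  have hint := integrable_indicator_height (a := a) hK hKv hg hg1
  rw [← integral_indicator hK, ← hmp.map_eq, integral_map hmp.measurable.aemeasurable
    (by rw [hmp.map_eq]; exact hint.aestronglyMeasurable)]
  have hint2 := (hmp.integrable_comp hint.aestronglyMeasurable).mpr hint
  rw [Measure.volume_eq_prod] at hint2 ⊢
  refine (integral_prod _ hint2).trans ?_
  exact integral_congr_ae (Eventually.of_forall fun t => integral_indicator_slice ha horth hK g t)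

theorem integrable_sliceVolume (ha : ‖a‖ = 1) (horth : ∀ v, inner ℝ a (ι v) = 0)
    (hspan : ∀ x : E, inner ℝ a x = 0 → ∃ v, ι v = x) {K : Set E} (hK : MeasurableSet K)
    (hKv : volume K ≠ ⊤) : Integrable (sliceVolume a ι K) := by
  have hmp := measurePreserving_smul_add ha horth hspan
  have hint := integrable_indicator_height (a := a) (g := fun _ => 1) hK hKv continuous_const
    (by simp)
  have hint2 := (hmp.integrable_comp hint.aestronglyMeasurable).mpr hint
  rw [Measure.volume_eq_prod] at hint2
  refine hint2.integral_prod_left.congr (Eventually.of_forall fun t => ?_)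
  exact (integral_indicator_slice ha horth hK (fun _ => 1) t).trans (mul_one _)

end Slicing

/-! ### The Fourier transform of a Euclidean ball -/

/-- The Beta integral after the substitution `x = t²`. -/
theorem integral_pow_mul_sqrt_one_sub_sq_pow (j k : ℕ) :
    ∫ t in (0 : ℝ)..1, t ^ (2 * j) * √(1 - t ^ 2) ^ k =
      1 / 2 * (Real.Gamma (j + 1 / 2) * Real.Gamma (k / 2 + 1) /
        Real.Gamma (j + (k + 1) / 2 + 1)) := by
  have hbeta : ∫ x in (0 : ℝ)..1, x ^ ((j : ℝ) - 1 / 2) * √(1 - x) ^ k =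
      Real.Gamma (j + 1 / 2) * Real.Gamma (k / 2 + 1) / Real.Gamma (j + (k + 1) / 2 + 1) := by
    have h := Complex.betaIntegral_eq_Gamma_mul_div ((j + 1 / 2 : ℝ) : ℂ) ((k / 2 + 1 : ℝ) : ℂ)
      (by rw [Complex.ofReal_re]; positivity) (by rw [Complex.ofReal_re]; positivity)
    rw [← Complex.ofReal_add, Complex.Gamma_ofReal, Complex.Gamma_ofReal, Complex.Gamma_ofReal,
      ← Complex.ofReal_mul, ← Complex.ofReal_div,
      show (j + 1 / 2 : ℝ) + (k / 2 + 1) = j + (k + 1) / 2 + 1 by ring] at h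
    rw [← Complex.ofReal_inj, ← h, Complex.betaIntegral, ← intervalIntegral.integral_ofReal]
    refine intervalIntegral.integral_congr fun x hx => ?_
    rw [Set.uIcc_of_le zero_le_one] at hx
    have hx1 : 0 ≤ 1 - x := sub_nonneg.mpr hx.2
    rw [← Complex.ofReal_one, ← Complex.ofReal_sub, ← Complex.ofReal_sub, ← Complex.ofReal_sub,
      ← Complex.ofReal_cpow hx.1, ← Complex.ofReal_cpow hx1, ← Complex.ofReal_mul,
      Real.sqrt_eq_rpow, ← Real.rpow_mul_natCast hx1]
    congr 3 <;> ring
  have hsub : ∀ t : ℝ, 0 < t → (t ^ 2) ^ ((j : ℝ) - 1 / 2) * √(1 - t ^ 2) ^ k * (2 * t) =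
      2 * (t ^ (2 * j) * √(1 - t ^ 2) ^ k) := by
    intro t ht
    have : (t ^ 2) ^ ((j : ℝ) - 1 / 2) * t = t ^ (2 * j) := by
      rw [← Real.rpow_natCast t 2, ← Real.rpow_mul ht.le, ← Real.rpow_natCast t (2 * j)]
      nth_rewrite 2 [← Real.rpow_one t]
      rw [← Real.rpow_add ht]
      congr 1
      push_cast
      ring
    linear_combination 2 * √(1 - t ^ 2) ^ k * this
  have hint : IntervalIntegrable (fun x : ℝ => x ^ ((j : ℝ) - 1 / 2) * √(1 - x) ^ k) volume 0 1 :=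
    (intervalIntegral.intervalIntegrable_rpow' (by
      have : (0 : ℝ) ≤ j := Nat.cast_nonneg j
      linarith)).mul_continuousOn (by fun_prop)
  have h := intervalIntegral.integral_comp_mul_deriv''' (a := (0 : ℝ)) (b := 1)
    (f := fun t => t ^ 2) (f' := fun t => 2 * t)
    (g := fun x : ℝ => x ^ ((j : ℝ) - 1 / 2) * √(1 - x) ^ k) (by fun_prop)
    (fun x _ => by simpa using (hasDerivAt_pow 2 x).hasDerivWithinAt) ?_ ?_ ?_
  · simp only [Function.comp_def] at h
    rw [zero_pow two_ne_zero, one_pow, hbeta] at h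
    rw [← h, ← intervalIntegral.integral_const_mul]
    refine intervalIntegral.integral_congr_ae (Eventually.of_forall fun t ht => ?_)
    rw [Set.uIoc_of_le zero_le_one] at ht
    rw [hsub t ht.1]
    ring
  · rintro _ ⟨t, ht, rfl⟩
    rw [min_eq_left zero_le_one] at ht
    have ht2 : t ^ 2 ≠ 0 := (pow_pos ht.1 2).ne'
    exact ((Real.continuousAt_rpow_const _ _ (Or.inl ht2)).mul (by fun_prop)).continuousWithinAt
  · refine ((intervalIntegrable_iff_integrableOn_Icc_of_le zero_le_one).mp hint).mono_set ?_
    rintro _ ⟨t, ht, rfl⟩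
    rw [Set.uIcc_of_le zero_le_one] at ht
    exact ⟨sq_nonneg t, pow_le_one₀ ht.1 ht.2⟩
  · rw [Set.uIcc_of_le zero_le_one, integrableOn_Icc_iff_integrableOn_Ioc]
    have hc : IntegrableOn (fun t : ℝ => 2 * (t ^ (2 * j) * √(1 - t ^ 2) ^ k)) (Set.Ioc 0 1) :=
      (Continuous.integrableOn_Icc (by fun_prop)).mono_set Set.Ioc_subset_Icc_self
    exact hc.congr_fun (fun t ht => (hsub t ht.1).symm) measurableSet_Ioc

theorem hasSum_integral_cos_mul_sqrt (k : ℕ) (z : ℝ) :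
    HasSum (fun j : ℕ => (-1 : ℝ) ^ j * z ^ (2 * j) / (2 * j).factorial *
        ∫ t in (0 : ℝ)..1, t ^ (2 * j) * √(1 - t ^ 2) ^ k)
      (∫ t in (0 : ℝ)..1, Real.cos (z * t) * √(1 - t ^ 2) ^ k) := by
  simp only [← intervalIntegral.integral_const_mul]
  refine intervalIntegral.hasSum_integral_of_dominated_convergence
    (fun j _ => |z| ^ (2 * j) / (2 * j).factorial) (fun j => ?_) (fun j => ?_) ?_ ?_ ?_
  · exact Continuous.aestronglyMeasurable (by fun_prop)
  · refine Eventually.of_forall fun t ht => ?_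
    rw [Set.uIoc_of_le zero_le_one] at ht
    have h1 : |t ^ (2 * j) * √(1 - t ^ 2) ^ k| ≤ 1 := by
      rw [abs_of_nonneg (by have := ht.1.le; positivity)]
      refine mul_le_one₀ (pow_le_one₀ ht.1.le ht.2) (by positivity)
        (pow_le_one₀ (Real.sqrt_nonneg _) ?_)
      rw [Real.sqrt_le_one]
      nlinarith [sq_nonneg t]
    rw [norm_mul, norm_div, norm_mul, norm_pow, norm_pow, norm_neg, norm_one, one_pow, one_mul,
      Real.norm_eq_abs, Real.norm_eq_abs, Real.norm_eq_abs, Nat.abs_cast]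
    exact mul_le_of_le_one_right (by positivity) h1
  · refine Eventually.of_forall fun t _ => ?_
    exact (Real.summable_pow_div_factorial |z|).comp_injective
      (i := fun j : ℕ => 2 * j) (fun a b h => by simpa using h)
  · exact intervalIntegrable_const
  · refine Eventually.of_forall fun t _ => ?_
    refine ((Real.hasSum_cos (z * t)).mul_right (√(1 - t ^ 2) ^ k)).congr_fun fun j => ?_
    rw [mul_pow]
    ring

/-- The normalized Bessel function is given by its even power series, also at the origin. -/
theorem normalizedBessel_eq_tsum {ν x : ℝ} (hν : 0 ≤ ν) (hx : 0 ≤ x) :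
    normalizedBessel ν x = Real.Gamma (ν + 1) *
      ∑' j : ℕ, (-1 : ℝ) ^ j * (x / 2) ^ (2 * j) / (j.factorial * Real.Gamma (j + ν + 1)) := by
  rcases hx.eq_or_lt with rfl | hx
  · have h : ∀ j : ℕ, j ≠ 0 → (-1 : ℝ) ^ j * ((0 : ℝ) / 2) ^ (2 * j) /
        (j.factorial * Real.Gamma (j + ν + 1)) = 0 := fun j hj => by simp [hj]
    rw [tsum_eq_single 0 h, normalizedBessel, if_pos rfl]
    have := (Real.Gamma_pos_of_pos (show 0 < ν + 1 by linarith)).ne'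
    simp [this]
  · rw [normalizedBessel, if_neg hx.ne', besselJ, ← tsum_div_const, ← tsum_mul_left,
      ← tsum_mul_left]
    refine tsum_congr fun j => ?_
    rw [Real.rpow_add (by positivity), show (2 * (j : ℝ)) = ((2 * j : ℕ) : ℝ) by push_cast; ring,
      Real.rpow_natCast, Real.div_rpow hx.le two_pos.le]
    have h1 : x ^ ν ≠ 0 := (Real.rpow_pos_of_pos hx _).ne'
    have h2 : (2 : ℝ) ^ ν ≠ 0 := (Real.rpow_pos_of_pos two_pos _).ne'
    field_simp

theorem gamma_nat_add_half_mul (j : ℕ) :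
    Real.Gamma (j + 1 / 2) * (4 ^ j * j.factorial) = (2 * j).factorial * √Real.pi := by
  induction j with
  | zero => rw [Nat.cast_zero, zero_add, Real.Gamma_one_half_eq]; simp
  | succ i ih =>
    have hs : ((i + 1 : ℕ) : ℝ) + 1 / 2 = i + 1 / 2 + 1 := by push_cast; ring
    rw [hs, Real.Gamma_add_one (by positivity), show 2 * (i + 1) = 2 * i + 1 + 1 by ring,
      Nat.factorial_succ, Nat.factorial_succ, Nat.factorial_succ]
    push_cast
    linear_combination (2 * i + 1) * (2 * (i + 1)) * ih

/-- Poisson's integral representation of the normalized Bessel function. -/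
theorem integral_cos_mul_sqrt_eq_bessel (k : ℕ) {z : ℝ} (hz : 0 ≤ z) :
    ∫ t in (0 : ℝ)..1, Real.cos (z * t) * √(1 - t ^ 2) ^ k =
      √Real.pi * Real.Gamma (k / 2 + 1) / (2 * Real.Gamma ((k + 1) / 2 + 1)) *
        normalizedBessel ((k + 1) / 2) z := by
  rw [normalizedBessel_eq_tsum (by positivity) hz, ← (hasSum_integral_cos_mul_sqrt k z).tsum_eq,
    ← mul_assoc, ← tsum_mul_left]
  refine tsum_congr fun j => ?_
  rw [integral_pow_mul_sqrt_one_sub_sq_pow]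
  have hG : Real.Gamma ((k + 1) / 2 + 1) ≠ 0 := (Real.Gamma_pos_of_pos (by positivity)).ne'
  have hG2 : Real.Gamma (j + (k + 1) / 2 + 1) ≠ 0 := (Real.Gamma_pos_of_pos (by positivity)).ne'
  have hdup := gamma_nat_add_half_mul j
  have hf : ((2 * j).factorial : ℝ) ≠ 0 := by positivity
  have hj : (j.factorial : ℝ) ≠ 0 := by positivity
  have e : (z / 2) ^ (2 * j) = z ^ (2 * j) / 4 ^ j := by
    rw [div_pow, pow_mul 2]; norm_num
  rw [e]
  generalize Real.Gamma (j + 1 / 2) = G₁ at hdup ⊢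
  generalize Real.Gamma (j + (k + 1) / 2 + 1) = G₂ at hG2 ⊢
  generalize Real.Gamma ((k + 1) / 2 + 1) = G₃ at hG ⊢
  generalize Real.Gamma (k / 2 + 1) = G₄
  field_simp
  linear_combination (z ^ (2 * j) * G₄) * hdup

theorem volume_real_closedBall_euclidean (k : ℕ) {R : ℝ} (hR : 0 ≤ R) :
    volume.real (Metric.closedBall (0 : EuclideanSpace ℝ (Fin k)) R) =
      R ^ k * (√Real.pi ^ k / Real.Gamma (k / 2 + 1)) := by
  rcases Nat.eq_zero_or_pos k with rfl | hk
  · have h : Metric.closedBall (0 : EuclideanSpace ℝ (Fin 0)) R = Set.univ :=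
      Set.eq_univ_of_forall fun x => by simpa [Subsingleton.elim x 0] using hR
    rw [h, measureReal_def, volume_euclideanSpace_eq_dirac]
    simp
  · have : Nonempty (Fin k) := ⟨⟨0, hk⟩⟩
    rw [measureReal_def, EuclideanSpace.volume_closedBall, Fintype.card_fin, ENNReal.toReal_mul,
      ENNReal.toReal_pow, ENNReal.toReal_ofReal hR, ENNReal.toReal_ofReal]
    exact div_nonneg (by positivity) (Real.Gamma_pos_of_pos (by positivity)).le

/-- The hyperplane orthogonal to a unit vector is a copy of a Euclidean space. -/
theorem exists_linearIsometry_onto_orthogonal (k : ℕ) {u : EuclideanSpace ℝ (Fin (k + 1))}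
    (hu : ‖u‖ = 1) : ∃ ι : EuclideanSpace ℝ (Fin k) →ₗᵢ[ℝ] EuclideanSpace ℝ (Fin (k + 1)),
      (∀ v, inner ℝ u (ι v) = 0) ∧ ∀ x, inner ℝ u x = 0 → ∃ v, ι v = x := by
  have hf : Fact (Module.finrank ℝ (EuclideanSpace ℝ (Fin (k + 1))) = k + 1) := ⟨by simp⟩
  have hu0 : u ≠ 0 := by rintro rfl; simp at hu
  let b := OrthonormalBasis.fromOrthogonalSpanSingleton (𝕜 := ℝ) k hu0
  refine ⟨(Submodule.subtypeₗᵢ _).comp b.repr.symm.toLinearIsometry, fun v => ?_, fun x hx => ?_⟩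
  · exact Submodule.mem_orthogonal_singleton_iff_inner_right.mp (b.repr.symm v).2
  · refine ⟨b.repr ⟨x, Submodule.mem_orthogonal_singleton_iff_inner_right.mpr hx⟩, ?_⟩
    simp

theorem sliceVolume_closedBall {k : ℕ} {u : EuclideanSpace ℝ (Fin (k + 1))} (hu : ‖u‖ = 1)
    {ι : EuclideanSpace ℝ (Fin k) →ₗᵢ[ℝ] EuclideanSpace ℝ (Fin (k + 1))}
    (horth : ∀ v, inner ℝ u (ι v) = 0) {r : ℝ} (hr : 0 ≤ r) (t : ℝ) :
    sliceVolume u ι (Metric.closedBall 0 r) t =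
      (Set.Icc (-r) r).indicator
        (fun t => √(r ^ 2 - t ^ 2) ^ k * (√Real.pi ^ k / Real.Gamma (k / 2 + 1))) t := by
  have hnorm : ∀ v, ‖t • u + ι v‖ ^ 2 = t ^ 2 + ‖v‖ ^ 2 := fun v => by
    rw [norm_add_sq_real, inner_smul_left, horth, norm_smul, hu, ι.norm_map]
    simp
  by_cases ht : t ∈ Set.Icc (-r) r
  · have h1 : 0 ≤ r ^ 2 - t ^ 2 := by
      rw [sub_nonneg]
      exact sq_le_sq' ht.1 ht.2
    rw [Set.indicator_of_mem ht, ← volume_real_closedBall_euclidean k (Real.sqrt_nonneg _),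
      sliceVolume]
    congr 1
    ext v
    simp only [Set.mem_ofPred_eq, mem_closedBall_zero_iff]
    rw [Real.le_sqrt (norm_nonneg _) h1, ← abs_of_nonneg hr, ← sq_le_sq₀ (norm_nonneg _)
      (abs_nonneg _), hnorm, abs_of_nonneg hr]
    constructor <;> intro h <;> linarith
  · rw [Set.indicator_of_notMem ht, sliceVolume]
    have : {v | t • u + ι v ∈ Metric.closedBall 0 r} = ∅ := by
      refine Set.eq_empty_of_forall_notMem fun v hv => ht ?_
      rw [Set.mem_ofPred_eq, mem_closedBall_zero_iff, ← sq_le_sq₀ (norm_nonneg _) hr, hnorm] at hv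
      rw [Set.mem_Icc, ← abs_le, ← sq_le_sq₀ (abs_nonneg _) hr, sq_abs]
      nlinarith [sq_nonneg ‖v‖]
    rw [this, measureReal_empty]

theorem integral_neg_one_one_of_even {f : ℝ → ℝ} (hf : Continuous f) (he : ∀ t, f (-t) = f t) :
    ∫ t in (-1 : ℝ)..1, f t = 2 * ∫ t in (0 : ℝ)..1, f t := by
  rw [← intervalIntegral.integral_add_adjacent_intervals (b := 0) (hf.intervalIntegrable _ _)
    (hf.intervalIntegrable _ _)]
  have h := intervalIntegral.integral_comp_neg (a := 0) (b := 1) f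
  simp only [he, neg_zero] at h
  rw [← h, two_mul]

/-- The cosine transform of a ball in the direction of a unit vector. -/
theorem setIntegral_closedBall_cos_unit {k : ℕ} {u : EuclideanSpace ℝ (Fin (k + 1))}
    (hu : ‖u‖ = 1) {r s : ℝ} (hr : 0 < r) (hs : 0 ≤ s) :
    ∫ y in Metric.closedBall (0 : EuclideanSpace ℝ (Fin (k + 1))) r, Real.cos (s * inner ℝ u y) =
      r ^ (k + 1) * (√Real.pi ^ (k + 1) / Real.Gamma ((k + 1) / 2 + 1)) *
        normalizedBessel ((k + 1) / 2) (s * r) := by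
  obtain ⟨ι, horth, hspan⟩ := exists_linearIsometry_onto_orthogonal k hu
  rw [setIntegral_height_eq hu horth hspan (g := fun t => Real.cos (s * t))
    Metric.isClosed_closedBall.measurableSet measure_closedBall_lt_top.ne (by fun_prop)
    (fun t => Real.abs_cos_le_one _)]
  set κ := √Real.pi ^ k / Real.Gamma (k / 2 + 1) with hκ
  have h1 : (fun t => sliceVolume u ι (Metric.closedBall 0 r) t * Real.cos (s * t)) =
      (Set.Icc (-r) r).indicator fun t => √(r ^ 2 - t ^ 2) ^ k * κ * Real.cos (s * t) := by
    ext t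
    rw [sliceVolume_closedBall hu horth hr.le]
    by_cases ht : t ∈ Set.Icc (-r) r
    · rw [Set.indicator_of_mem ht, Set.indicator_of_mem ht]
    · rw [Set.indicator_of_notMem ht, Set.indicator_of_notMem ht, zero_mul]
  rw [h1, integral_indicator measurableSet_Icc, integral_Icc_eq_integral_Ioc,
    ← intervalIntegral.integral_of_le (by linarith)]
  have h2 := intervalIntegral.mul_integral_comp_mul_left (a := -1) (b := 1)
    (f := fun t => √(r ^ 2 - t ^ 2) ^ k * κ * Real.cos (s * t)) r
  rw [mul_one, mul_neg_one] at h2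
  have h3 : ∀ t : ℝ, √(r ^ 2 - (r * t) ^ 2) ^ k * κ * Real.cos (s * (r * t)) =
      r ^ k * κ * (Real.cos (s * r * t) * √(1 - t ^ 2) ^ k) := fun t => by
    rw [show r ^ 2 - (r * t) ^ 2 = r ^ 2 * (1 - t ^ 2) by ring, Real.sqrt_mul (sq_nonneg r),
      Real.sqrt_sq hr.le, mul_pow, mul_assoc s]
    ring
  simp only [h3] at h2
  rw [← h2, intervalIntegral.integral_const_mul, integral_neg_one_one_of_even (by fun_prop)
    (fun t => by rw [mul_neg, Real.cos_neg, neg_sq]),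
    integral_cos_mul_sqrt_eq_bessel k (by positivity), hκ]
  have hG : Real.Gamma (k / 2 + 1) ≠ 0 := (Real.Gamma_pos_of_pos (by positivity)).ne'
  generalize Real.Gamma (k / 2 + 1) = G at hG ⊢
  generalize Real.Gamma ((k + 1) / 2 + 1) = G'
  field_simp
  ring

/-- The cosine transform of a ball is a Bessel function. -/
theorem setIntegral_closedBall_cos {m : ℕ} (hm : 0 < m) (b : EuclideanSpace ℝ (Fin m))
    {r s : ℝ} (hr : 0 < r) (hs : 0 ≤ s) :
    ∫ y in Metric.closedBall (0 : EuclideanSpace ℝ (Fin m)) r, Real.cos (s * inner ℝ b y) =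
      r ^ m * (√Real.pi ^ m / Real.Gamma (m / 2 + 1)) *
        normalizedBessel (m / 2) (‖b‖ * r * s) := by
  obtain ⟨k, rfl⟩ : ∃ k, m = k + 1 := ⟨m - 1, by omega⟩
  -- For `b = 0` any unit vector serves as the direction.
  obtain ⟨u, hu, hbu⟩ : ∃ u : EuclideanSpace ℝ (Fin (k + 1)), ‖u‖ = 1 ∧ b = ‖b‖ • u := by
    rcases eq_or_ne b 0 with rfl | hb
    · exact ⟨EuclideanSpace.single 0 1, by simp, by simp⟩
    · have hb' : ‖b‖ ≠ 0 := norm_ne_zero_iff.mpr hb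
      exact ⟨‖b‖⁻¹ • b, by rw [norm_smul, norm_inv, norm_norm, inv_mul_cancel₀ hb'],
        by rw [smul_smul, mul_inv_cancel₀ hb', one_smul]⟩
  have h := setIntegral_closedBall_cos_unit hu hr (mul_nonneg (norm_nonneg b) hs)
  have e : ∀ y, s * inner ℝ b y = ‖b‖ * s * inner ℝ u y := fun y => by
    conv_lhs => rw [hbu, inner_smul_left]
    simp only [conj_trivial]
    ring
  simp only [e]
  rw [h]
  push_cast
  rw [mul_right_comm ‖b‖ s r]

/-! ### The Fourier transform of the generalized cylinder -/

theorem setIntegral_Icc_exp_eq_sinc (c : ℝ) :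
    ∫ x in Set.Icc (-(1 / 2) : ℝ) (1 / 2), Complex.exp ((c * x : ℝ) * Complex.I) =
      (Real.sinc (c / 2) : ℂ) := by
  rw [integral_Icc_eq_integral_Ioc, ← intervalIntegral.integral_of_le (by norm_num)]
  rcases eq_or_ne c 0 with rfl | hc
  · simp
    norm_num
  have h := intervalIntegral.integral_comp_mul_left (a := -(1 / 2)) (b := 1 / 2)
    (fun x : ℝ => Complex.exp ((x : ℂ) * Complex.I)) hc
  rw [h, show c * -(1 / 2) = -(c / 2) by ring, show c * (1 / 2) = c / 2 by ring,
    integral_exp_mul_I_eq_sinc, Complex.real_smul]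
  have hc' : (c : ℂ) ≠ 0 := Complex.ofReal_ne_zero.mpr hc
  push_cast
  field_simp

theorem setIntegral_cube_exp {n : ℕ} (b : EuclideanSpace ℝ (Fin n)) (s : ℝ) :
    ∫ x in {x : EuclideanSpace ℝ (Fin n) | ∀ j, x j ∈ Set.Icc (-(1 / 2) : ℝ) (1 / 2)},
      Complex.exp ((s * inner ℝ b x : ℝ) * Complex.I) =
      ((∏ j, Real.sinc (b j * s / 2) : ℝ) : ℂ) := by
  have hemb : MeasurableEmbedding (WithLp.toLp 2 : (Fin n → ℝ) → EuclideanSpace ℝ (Fin n)) :=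
    (MeasurableEquiv.toLp 2 (Fin n → ℝ)).measurableEmbedding
  rw [← (PiLp.volume_preserving_toLp (Fin n)).setIntegral_preimage_emb hemb]
  have hset : (WithLp.toLp 2 : (Fin n → ℝ) → EuclideanSpace ℝ (Fin n)) ⁻¹'
      {x | ∀ j, x j ∈ Set.Icc (-(1 / 2) : ℝ) (1 / 2)} =
      Set.univ.pi fun _ => Set.Icc (-(1 / 2) : ℝ) (1 / 2) := by
    ext x
    simp only [Set.mem_preimage, Set.mem_ofPred_eq, Set.mem_univ_pi]
  have hf : ∀ x : Fin n → ℝ,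
      Complex.exp ((s * inner ℝ b (WithLp.toLp 2 x : EuclideanSpace ℝ (Fin n)) : ℝ) * Complex.I) =
      ∏ j, Complex.exp ((b j * s * x j : ℝ) * Complex.I) := fun x => by
    rw [← Complex.exp_sum, ← Finset.sum_mul, ← Complex.ofReal_sum, PiLp.inner_apply,
      Finset.mul_sum]
    congr 4
    ext j
    simp
    ring
  rw [hset, volume_pi, Measure.restrict_pi_pi]
  simp only [hf]
  rw [integral_fintype_prod_eq_prod (fun j x => Complex.exp ((b j * s * x : ℝ) * Complex.I))]
  rw [Complex.ofReal_prod]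
  exact Finset.prod_congr rfl fun j _ => setIntegral_Icc_exp_eq_sinc _

/-- Splitting off the last block of coordinates preserves Lebesgue measure. -/
theorem measurePreserving_finAddEquivProd (n m : ℕ) :
    MeasurePreserving (EuclideanSpace.finAddEquivProd (𝕜 := ℝ) (n := n) (m := m)) := by
  have h := ((LinearIsometryEquiv.piLpCongrLeft 2 ℝ ℝ (finSumFinEquiv (m := n) (n := m)).symm).trans
    (PiLp.sumPiLpEquivProdLpPiLp 2 fun _ => ℝ)).measurePreserving
  exact (WithLp.volume_preserving_ofLp (EuclideanSpace ℝ (Fin n)) (EuclideanSpace ℝ (Fin m))).comp h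

theorem finAddEquivProd_fst_apply {n m : ℕ} (x : EuclideanSpace ℝ (Fin (n + m))) (j : Fin n) :
    (EuclideanSpace.finAddEquivProd x).1 j = x (Fin.castAdd m j) := rfl

theorem finAddEquivProd_snd_apply {n m : ℕ} (x : EuclideanSpace ℝ (Fin (n + m))) (k : Fin m) :
    (EuclideanSpace.finAddEquivProd x).2 k = x (Fin.natAdd n k) := rfl

theorem lastBlockNorm_eq_norm {n m : ℕ} (x : EuclideanSpace ℝ (Fin (n + m))) :
    lastBlockNorm x = ‖(EuclideanSpace.finAddEquivProd x).2‖ := by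
  simp [lastBlockNorm, EuclideanSpace.norm_eq]

theorem generalizedCylinder_eq_preimage (n m : ℕ) (r : ℝ) :
    generalizedCylinder n m r = EuclideanSpace.finAddEquivProd ⁻¹'
      ({x : EuclideanSpace ℝ (Fin n) | ∀ j, x j ∈ Set.Icc (-(1 / 2) : ℝ) (1 / 2)} ×ˢ
        Metric.closedBall (0 : EuclideanSpace ℝ (Fin m)) r) := by
  ext x
  simp only [generalizedCylinder, Set.mem_ofPred_eq, Set.mem_preimage, Set.mem_prod,
    mem_closedBall_zero_iff, lastBlockNorm_eq_norm, finAddEquivProd_fst_apply]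

theorem inner_eq_add_finAddEquivProd {n m : ℕ} (a x : EuclideanSpace ℝ (Fin (n + m))) :
    inner ℝ a x =
      inner ℝ (EuclideanSpace.finAddEquivProd a).1 (EuclideanSpace.finAddEquivProd x).1 +
      (inner ℝ (EuclideanSpace.finAddEquivProd a).2 (EuclideanSpace.finAddEquivProd x).2 : ℝ) := by
  simp only [PiLp.inner_apply, Fin.sum_univ_add, finAddEquivProd_fst_apply,
    finAddEquivProd_snd_apply]

/-- The cosine transform of the generalized cylinder is the integrand of the section formula. -/
theorem setIntegral_generalizedCylinder_cos {n m : ℕ} (hm : 0 < m) {r s : ℝ} (hr : 0 < r)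
    (hs : 0 ≤ s) (a : EuclideanSpace ℝ (Fin (n + m))) :
    ∫ x in generalizedCylinder n m r, Real.cos (s * inner ℝ a x) =
      r ^ m * (√Real.pi ^ m / Real.Gamma (m / 2 + 1)) *
        cylinderIntegrand n m r a (lastBlockNorm a) s := by
  set a₁ := (EuclideanSpace.finAddEquivProd a).1 with ha₁
  set a₂ := (EuclideanSpace.finAddEquivProd a).2 with ha₂
  set B := Metric.closedBall (0 : EuclideanSpace ℝ (Fin m)) r with hB
  let f : EuclideanSpace ℝ (Fin n) → ℂ := fun x => Complex.exp ((s * inner ℝ a₁ x : ℝ) * Complex.I)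
  let g : EuclideanSpace ℝ (Fin m) → ℂ := fun y => Complex.exp ((s * inner ℝ a₂ y : ℝ) * Complex.I)
  have hcos : ∀ x, Real.cos (s * inner ℝ a x) =
      (f (EuclideanSpace.finAddEquivProd x).1 * g (EuclideanSpace.finAddEquivProd x).2).re := by
    intro x
    simp only [f, g]
    rw [← Complex.exp_add, ← add_mul, ← Complex.ofReal_add, ← mul_add,
      ← inner_eq_add_finAddEquivProd, Complex.exp_ofReal_mul_I_re]
  have hcube : volume {x : EuclideanSpace ℝ (Fin n) | ∀ j, x j ∈ Set.Icc (-(1 / 2) : ℝ) (1 / 2)} ≠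
      ⊤ := by
    have hset : {x : EuclideanSpace ℝ (Fin n) | ∀ j, x j ∈ Set.Icc (-(1 / 2) : ℝ) (1 / 2)} =
        WithLp.ofLp ⁻¹' (Set.univ.pi fun _ => Set.Icc (-(1 / 2) : ℝ) (1 / 2)) := by
      ext x
      simp only [Set.mem_preimage, Set.mem_ofPred_eq, Set.mem_univ_pi]
    rw [hset, (PiLp.volume_preserving_ofLp (Fin n)).measure_preimage
      (MeasurableSet.univ_pi fun _ => measurableSet_Icc).nullMeasurableSet]
    exact (isCompact_univ_pi fun _ => isCompact_Icc).measure_lt_top.ne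
  have hfi : IntegrableOn f
      {x : EuclideanSpace ℝ (Fin n) | ∀ j, x j ∈ Set.Icc (-(1 / 2) : ℝ) (1 / 2)} :=
    Measure.integrableOn_of_bounded (M := 1) hcube
      (Continuous.aestronglyMeasurable (by fun_prop))
      (Eventually.of_forall fun x => (Complex.norm_exp_ofReal_mul_I _).le)
  have hgi : IntegrableOn g B :=
    Measure.integrableOn_of_bounded (M := 1) measure_closedBall_lt_top.ne
      (Continuous.aestronglyMeasurable (by fun_prop))
      (Eventually.of_forall fun x => (Complex.norm_exp_ofReal_mul_I _).le)
  have hfg := hfi.integrable.mul_prod hgi.integrable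
  rw [Measure.prod_restrict] at hfg
  have hgre : (∫ y in B, g y).re = ∫ y in B, Real.cos (s * inner ℝ a₂ y) := by
    rw [← Complex.reCLM_apply, ← Complex.reCLM.integral_comp_comm hgi]
    simp only [g, Complex.reCLM_apply, Complex.exp_ofReal_mul_I_re]
  simp only [hcos]
  rw [generalizedCylinder_eq_preimage,
    (measurePreserving_finAddEquivProd n m).setIntegral_preimage_emb
    EuclideanSpace.finAddEquivProd.toHomeomorph.measurableEmbedding (fun p => (f p.1 * g p.2).re)]
  simp only [← Complex.reCLM_apply]
  rw [Measure.volume_eq_prod, Complex.reCLM.integral_comp_comm hfg, setIntegral_prod_mul,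
    setIntegral_cube_exp, Complex.reCLM_apply, Complex.re_ofReal_mul, hgre,
    setIntegral_closedBall_cos hm _ hr hs, cylinderIntegrand, lastBlockNorm_eq_norm]
  simp only [ha₁, finAddEquivProd_fst_apply]
  ring

/-! ### The section formula -/

theorem convex_generalizedCylinder (n m : ℕ) (r : ℝ) : Convex ℝ (generalizedCylinder n m r) := by
  rw [generalizedCylinder_eq_preimage]
  refine Convex.linear_preimage ?_ EuclideanSpace.finAddEquivProd.toLinearMap
  refine Convex.prod (fun x hx y hy α β hα hβ hαβ j => ?_) (convex_closedBall _ _)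
  exact (convex_Icc (-(1 / 2) : ℝ) (1 / 2)) (hx j) (hy j) hα hβ hαβ

theorem isClosed_generalizedCylinder (n m : ℕ) (r : ℝ) : IsClosed (generalizedCylinder n m r) := by
  rw [generalizedCylinder_eq_preimage]
  refine IsClosed.preimage EuclideanSpace.finAddEquivProd.continuous
    (IsClosed.prod ?_ Metric.isClosed_closedBall)
  simp only [Set.ofPred_forall]
  exact isClosed_iInter fun j => isClosed_Icc.preimage (by fun_prop)

theorem norm_sq_le_of_mem_generalizedCylinder {n m : ℕ} {r : ℝ}
    {x : EuclideanSpace ℝ (Fin (n + m))} (hx : x ∈ generalizedCylinder n m r) :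
    ‖x‖ ^ 2 ≤ n * (1 / 2) ^ 2 + r ^ 2 := by
  have h2 : lastBlockNorm x ^ 2 ≤ r ^ 2 :=
    pow_le_pow_left₀ (Real.sqrt_nonneg _) hx.2 2
  rw [lastBlockNorm, Real.sq_sqrt (Finset.sum_nonneg fun _ _ => sq_nonneg _)] at h2
  rw [EuclideanSpace.norm_sq_eq, Fin.sum_univ_add]
  simp only [Real.norm_eq_abs, sq_abs]
  refine add_le_add ?_ h2
  refine (Finset.sum_le_card_nsmul _ _ ((1 / 2) ^ 2) fun j _ => ?_).trans (by simp)
  exact sq_le_sq' (hx.1 j).1 (hx.1 j).2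

theorem isBounded_generalizedCylinder (n m : ℕ) (r : ℝ) :
    Bornology.IsBounded (generalizedCylinder n m r) := by
  refine isBounded_iff_forall_norm_le.mpr ⟨√(n * (1 / 2) ^ 2 + r ^ 2), fun x hx => ?_⟩
  exact Real.le_sqrt_of_sq_le (norm_sq_le_of_mem_generalizedCylinder hx)

theorem closedBall_subset_generalizedCylinder (n m : ℕ) (r : ℝ) :
    Metric.closedBall 0 (min r (1 / 2)) ⊆ generalizedCylinder n m r := by
  intro x hx
  rw [mem_closedBall_zero_iff, le_min_iff] at hx
  refine ⟨fun j => ?_, ?_⟩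
  · rw [Set.mem_Icc, ← abs_le, ← Real.norm_eq_abs]
    exact (PiLp.norm_apply_le x _).trans hx.2
  · refine le_trans (Real.sqrt_le_sqrt ?_) ((EuclideanSpace.norm_eq x).ge.trans hx.1)
    rw [Fin.sum_univ_add]
    simp only [Real.norm_eq_abs, sq_abs]
    exact le_add_of_nonneg_left (Finset.sum_nonneg fun _ _ => sq_nonneg _)

/-- The section formula, for any model `ι` of the hyperplane orthogonal to `a`. -/
theorem hasImproperIntegral_cylinderIntegrand {n m : ℕ} (hm : 0 < m) {r : ℝ} (hr : 0 < r)
    {a : EuclideanSpace ℝ (Fin (n + m))} (ha : ‖a‖ = 1) {F : Type*} [NormedAddCommGroup F]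
    [InnerProductSpace ℝ F] [FiniteDimensional ℝ F] [MeasurableSpace F] [BorelSpace F]
    {ι : F →ₗᵢ[ℝ] EuclideanSpace ℝ (Fin (n + m))} (horth : ∀ v, inner ℝ a (ι v) = 0)
    (hspan : ∀ x, inner ℝ a x = 0 → ∃ v, ι v = x) :
    HasImproperIntegral (cylinderIntegrand n m r a (lastBlockNorm a))
      ((r ^ m * (√Real.pi ^ m / Real.Gamma (m / 2 + 1)))⁻¹ *
        (Real.pi * sliceVolume a ι (generalizedCylinder n m r) 0)) := by
  set K := generalizedCylinder n m r with hK
  set A := sliceVolume a ι K with hA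
  set c := r ^ m * (√Real.pi ^ m / Real.Gamma (m / 2 + 1)) with hc
  have hc0 : c ≠ 0 := by
    have := Real.Gamma_pos_of_pos (show 0 < (m : ℝ) / 2 + 1 by positivity)
    positivity
  have hKm : MeasurableSet K := (isClosed_generalizedCylinder n m r).measurableSet
  have hKb : Bornology.IsBounded K := isBounded_generalizedCylinder n m r
  have hKv : volume K ≠ ⊤ := hKb.measure_lt_top.ne
  have hAi : Integrable A := integrable_sliceVolume ha horth hspan hKm hKv
  obtain ⟨C, δ, hδ, hlip⟩ := sliceVolume_lipschitz_zero (ι := ι) ha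
    (convex_generalizedCylinder n m r) hKb (lt_min hr one_half_pos)
    (closedBall_subset_generalizedCylinder n m r)
  have heq : ∀ s, 0 ≤ s → c⁻¹ * ∫ t, A t * Real.cos (s * t) =
      cylinderIntegrand n m r a (lastBlockNorm a) s := by
    intro s hs
    rw [← setIntegral_height_eq ha horth hspan hKm hKv (g := fun t => Real.cos (s * t))
      (by fun_prop) (fun t => Real.abs_cos_le_one _),
      setIntegral_generalizedCylinder_cos hm hr hs a, inv_mul_cancel_left₀ hc0]
  refine ⟨fun T hT => ?_, ?_⟩
  · refine (((continuous_cosTransform hAi).const_mul c⁻¹).intervalIntegrable 0 T).congr ?_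
    intro s hs
    rw [Set.uIoc_of_le hT.le] at hs
    exact heq s hs.1.le
  · refine ((tendsto_integral_cosTransform hAi hδ hlip).const_mul c⁻¹).congr' ?_
    filter_upwards [eventually_ge_atTop 0] with T hT
    rw [← intervalIntegral.integral_const_mul]
    refine intervalIntegral.integral_congr fun s hs => ?_
    rw [Set.uIcc_of_le hT] at hs
    exact heq s hs.1

/-- The first part is the formula for an arbitrary unit normal vector `a`, where the role of
`a_{n+1}` is played by the norm of the last block of coordinates; the second part is the formula
for `a` in the position `a = (a_1, …, a_{n+1}, 0, …, 0)`, `a_{n+1} ≥ 0`. -/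
theorem theorem1 (n m : ℕ) (hm : 0 < m) (r : ℝ) (hr : 0 < r)
    (a : EuclideanSpace ℝ (Fin (n + m))) (ha : ‖a‖ = 1) :
    sectionVolume (centralHyperplane a) (generalizedCylinder n m r) ≠ ⊤ ∧
    (∃ I : ℝ, HasImproperIntegral (cylinderIntegrand n m r a (lastBlockNorm a)) I ∧
      (sectionVolume (centralHyperplane a) (generalizedCylinder n m r)).toReal =
        r ^ m * (Real.pi ^ ((m : ℝ) / 2 - 1) / Real.Gamma ((m : ℝ) / 2 + 1)) * I) ∧
    (0 ≤ a (Fin.natAdd n ⟨0, hm⟩) →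
      (∀ k : Fin m, k ≠ ⟨0, hm⟩ → a (Fin.natAdd n k) = 0) →
      ∃ I : ℝ,
        HasImproperIntegral (cylinderIntegrand n m r a (a (Fin.natAdd n ⟨0, hm⟩))) I ∧
        (sectionVolume (centralHyperplane a) (generalizedCylinder n m r)).toReal =
          r ^ m * (Real.pi ^ ((m : ℝ) / 2 - 1) / Real.Gamma ((m : ℝ) / 2 + 1)) * I) := by
  set V := centralHyperplane a with hV
  set Z := generalizedCylinder n m r with hZ
  have horth : ∀ v : V, inner ℝ a (V.subtypeₗᵢ v) = 0 := fun v => v.2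
  have hspan : ∀ x, inner ℝ a x = 0 → ∃ v : V, V.subtypeₗᵢ v = x := fun x hx => ⟨⟨x, hx⟩, rfl⟩
  have hset : {v : V | (0 : ℝ) • a + V.subtypeₗᵢ v ∈ Z} = ((↑) ⁻¹' Z : Set V) := by
    ext v
    simp
  have hvol : (sectionVolume V Z).toReal = sliceVolume a V.subtypeₗᵢ Z 0 := by
    rw [sliceVolume, hset]
    rfl
  have hfin : sectionVolume V Z ≠ ⊤ := by
    have h := volume_slice_lt_top (a := a) (ι := V.subtypeₗᵢ)
      (isBounded_generalizedCylinder n m r) 0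
    rw [← hZ, hset] at h
    exact h.ne
  have hmain := hasImproperIntegral_cylinderIntegrand hm hr ha horth hspan
  rw [← hZ, ← hvol] at hmain
  have hvalue : (sectionVolume V Z).toReal =
      r ^ m * (Real.pi ^ ((m : ℝ) / 2 - 1) / Real.Gamma ((m : ℝ) / 2 + 1)) *
        ((r ^ m * (√Real.pi ^ m / Real.Gamma (m / 2 + 1)))⁻¹ *
          (Real.pi * (sectionVolume V Z).toReal)) := by
    have hG : Real.Gamma ((m : ℝ) / 2 + 1) ≠ 0 := (Real.Gamma_pos_of_pos (by positivity)).ne'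
    have hpow : √Real.pi ^ m = Real.pi ^ ((m : ℝ) / 2) := by
      rw [Real.sqrt_eq_rpow, ← Real.rpow_mul_natCast Real.pi_pos.le]
      congr 1
      ring
    have hp : Real.pi ^ ((m : ℝ) / 2) ≠ 0 := (Real.rpow_pos_of_pos Real.pi_pos _).ne'
    rw [hpow, Real.rpow_sub_one Real.pi_ne_zero]
    generalize Real.Gamma ((m : ℝ) / 2 + 1) = G at hG ⊢
    generalize Real.pi ^ ((m : ℝ) / 2) = P at hp ⊢
    field_simp
  refine ⟨hfin, ⟨_, hmain, hvalue⟩, fun h0 hk => ⟨_, ?_, hvalue⟩⟩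
  have hblock : lastBlockNorm a = a (Fin.natAdd n ⟨0, hm⟩) := by
    rw [lastBlockNorm, Finset.sum_eq_single (⟨0, hm⟩ : Fin m)
      (fun k _ hk0 => by rw [hk k hk0]; ring) (fun h => absurd (Finset.mem_univ _) h),
      Real.sqrt_sq h0]
  rwa [← hblock]
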